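/- Let $G$ be a finite group. Write $\mathbb Z_+=\{0,1,2,\dots\}$, let $\mathbb ZG$ be the integral group ring, and let $\mathbb Z_+G$ be the set of $\sum_g n_g g$ in $\mathbb ZG$ with all $n_g\in\mathbb Z_+$. All matrices are finite. We use the following definitions. - A square matrix $A$ over $\mathbb Z_+G$ of size at least $1$ is *$G$-primitive* if for some $k>0$ every entry $\sum_g n_g g$ of $A^k$ satisfies $n_g>0$ for all $g\in G$. - $\overline A$ is the matrix over $\mathbb Z_+$ obtained from $A$ by applying $\sum_g n_g g\mapsto\sum_g n_g$ to each entry. - Square matrices $C,D$ over $\mathbb Z_+$, possibly of different sizes, are *strong shift equivalent (SSE) over $\mathbb Z_+$* if there is a finite chain $C=C_0,C_1,\dots,C_m=D$ of square matrices over $\mathbb Z_+$ such that for each $i$ there are matrices $U,V$ over $\mathbb Z_+$ with $C_i=UV$ and $C_{i+1}=VU$. - Square matrices $C,D$ over $\mathbb ZG$, possibly of different sizes, are *shift equivalent (SE) over $\mathbb ZG$* if there are matrices $U,V$ over $\mathbb ZG$ and an integer $\ell>0$ with $C^\ell=UV$, $D^\ell=VU$, $CU=UD$ and $DV=VC$.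 This is an equivalence relation; its classes are the SE-$\mathbb ZG$ classes. - A square matrix $A$ over $\mathbb Z_+G$ is the adjacency matrix of a directed graph with edges labelled by $G$: if $A(i,j)=\sum_g n_g g$, there are exactly $n_g$ edges from $i$ to $j$ with label $g$. Let $(X,S)$ be the edge shift of this graph (the bi-infinite paths $x=(x_k)_{k\in\mathbb Z}$, with $(Sx)_k=x_{k+1}$), and let $\tau(x)\in G$ be the label of the edge $x_0$. For $g\in G$ let $\kappa(g)$ be its conjugacy class. The *periodic data* of $A$ is the formal power series with coefficients in the free abelian group on the conjugacy classes of $G$ $$P_A=\sum_{n=1}^\infty\Big(\sum_{x\in X,\ S^nx=x}\kappa\big(\tau(x)\tau(Sx)\cdots\tau(S^{n-1}x)\big)\Big)t^n .$$ - For a $G$-primitive matrix $A$, $\mathfrak M(A)$ is the collection of all $G$-primitive matrices $B$ over $\mathbb Z_+G$ such that $\overline A$ and $\overline B$ are SSE over $\mathbb Z_+$ and $P_B=P_A$. **Theorem.** For every nontrivial finite group $G$ there is a $G$-primitive matrix $A$ such that the matrices in $\mathfrak M(A)$ represent infinitely many distinct SE-$\mathbb ZG$ classes. -/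

import Mathlib

namespace GExt

/-- A finite square matrix over `R`, of any size. -/
abbrev SqMat (R : Type*) := Σ n : ℕ, Matrix (Fin n) (Fin n) R

section Equivalences

variable {R : Type*} [Semiring R]

/-- Elementary strong shift equivalence over a semiring: `A = U V` and `B = V U` for some
rectangular matrices `U`, `V` over `R`. -/
def ElemSSE (A B : SqMat R) : Prop :=
  ∃ (U : Matrix (Fin A.1) (Fin B.1) R) (V : Matrix (Fin B.1) (Fin A.1) R),
    A.2 = U * V ∧ B.2 = V * U

/-- Strong shift equivalence over a semiring: a finite chain of elementary strong shift
equivalences (the elementary relation is already symmetric and reflexive). -/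
def SSE (A B : SqMat R) : Prop := Relation.ReflTransGen ElemSSE A B

/-- Shift equivalence over a semiring, with some positive lag `l`. -/
def SE (A B : SqMat R) : Prop :=
  ∃ (l : ℕ) (U : Matrix (Fin A.1) (Fin B.1) R) (V : Matrix (Fin B.1) (Fin A.1) R),
    0 < l ∧ A.2 ^ l = U * V ∧ B.2 ^ l = V * U ∧ A.2 * U = U * B.2 ∧ B.2 * V = V * A.2

theorem SE.refl (A : SqMat R) : SE A A :=
  ⟨1, A.2, 1, one_pos, by simp, by simp, rfl, by simp⟩

theorem SE.symm {A B : SqMat R} : SE A B → SE B A := by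
  rintro ⟨l, U, V, hl, h1, h2, h3, h4⟩
  exact ⟨l, V, U, hl, h2, h1, h4, h3⟩

theorem pow_intertwine {m n : ℕ} {A : Matrix (Fin m) (Fin m) R} {B : Matrix (Fin n) (Fin n) R}
    {U : Matrix (Fin m) (Fin n) R} (h : A * U = U * B) (k : ℕ) : A ^ k * U = U * B ^ k := by
  induction k with
  | zero => simp
  | succ k ih =>
    rw [pow_succ, Matrix.mul_assoc, h, ← Matrix.mul_assoc, ih, Matrix.mul_assoc, ← pow_succ]

theorem SE.trans {A B C : SqMat R} : SE A B → SE B C → SE A C := by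
  rintro ⟨l, U, V, hl, h1, h2, h3, h4⟩ ⟨m, U', V', hm, k1, k2, k3, k4⟩
  refine ⟨l + m, U * U', V' * V, by omega, ?_, ?_, ?_, ?_⟩
  · calc A.2 ^ (l + m) = A.2 ^ m * (U * V) := by rw [add_comm, pow_add, h1]
      _ = U * B.2 ^ m * V := by rw [← Matrix.mul_assoc, pow_intertwine h3]
      _ = U * U' * (V' * V) := by rw [k1]; simp only [Matrix.mul_assoc]
  · calc C.2 ^ (l + m) = C.2 ^ l * (V' * U') := by rw [pow_add, k2]
      _ = V' * B.2 ^ l * U' := by rw [← Matrix.mul_assoc, pow_intertwine k4]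
      _ = V' * V * (U * U') := by rw [h2]; simp only [Matrix.mul_assoc]
  · rw [← Matrix.mul_assoc, h3, Matrix.mul_assoc, k3, Matrix.mul_assoc]
  · rw [← Matrix.mul_assoc, k4, Matrix.mul_assoc, h4, Matrix.mul_assoc]

variable (R) in
/-- Shift equivalence over `R` as an equivalence relation on all square matrices over `R`. -/
def seSetoid : Setoid (SqMat R) := ⟨SE, SE.refl, SE.symm, SE.trans⟩

variable (R) in
/-- The set of SE-`R` classes. -/
def SEClass : Type _ := Quotient (seSetoid R)

/-- The SE-`R` class of a square matrix. -/
def seClass (A : SqMat R) : SEClass R := Quotient.mk (seSetoid R) A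

end Equivalences

noncomputable section

variable {G : Type*} [Group G]

/-- The augmentation `∑ n_g g ↦ ∑ n_g` from `ℤ₊G` to `ℤ₊`, applied entrywise. Here `ℤ₊ = ℕ` and
`ℤ₊G` is the monoid algebra of `G` over the semiring `ℕ`. -/
def aug (A : SqMat (MonoidAlgebra ℕ G)) : SqMat ℕ :=
  ⟨A.1, A.2.map (MonoidAlgebra.lift ℕ ℕ G 1)⟩

/-- A matrix over `ℤ₊G` regarded as a matrix over `ℤG`. -/
def toZG (A : SqMat (MonoidAlgebra ℕ G)) : SqMat (MonoidAlgebra ℤ G) :=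
  ⟨A.1, A.2.map (MonoidAlgebra.mapRingHom G (Nat.castRingHom ℤ))⟩

/-- `A` is `G`-primitive: some power `A ^ k`, `k > 0`, has all its entries `≫ 0`, i.e. every group
element occurs with a positive coefficient in every entry. Matrices have at least one row. -/
def GPrimitive (A : SqMat (MonoidAlgebra ℕ G)) : Prop :=
  0 < A.1 ∧ ∃ k : ℕ, 0 < k ∧ ∀ (i j : Fin A.1) (g : G), 0 < ((A.2 ^ k) i j).coeff g

/-- The periodic data of a system `(X, S)` with skewing function `τ : X → G`: the formal power
series over the free abelian group on the conjugacy classes of `G`, whose coefficient at `t ^ n`,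
`n ≥ 1`, is the sum over `x ∈ Fix (S ^ n)` of the conjugacy class of
`τ x * τ (S x) * ⋯ * τ (S ^ (n - 1) x)`. (To be used when all the sets `Fix (S ^ n)`, `n ≥ 1`, are
finite.) -/
def periodicData {X : Type*} (S : X → X) (τ : X → G) : PowerSeries (ConjClasses G →₀ ℤ) :=
  PowerSeries.mk fun n => if n = 0 then 0 else
    ∑ᶠ x ∈ {x : X | S^[n] x = x},
      Finsupp.single (ConjClasses.mk (List.ofFn fun i : Fin n => τ (S^[i] x)).prod) 1

/-- The edges of the labelled directed graph with adjacency matrix `A` over `ℤ₊G`: there are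
exactly `n_g` edges with label `g` from `i` to `j`, when `A i j = ∑ n_g g`. -/
structure Edge (A : SqMat (MonoidAlgebra ℕ G)) where
  src : Fin A.1
  tgt : Fin A.1
  label : G
  index : Fin ((A.2 src tgt).coeff label)

/-- The points of the edge shift of finite type of `A`: the bi-infinite paths in its graph. -/
def EdgeShift (A : SqMat (MonoidAlgebra ℕ G)) : Type _ :=
  {x : ℤ → Edge A // ∀ k, (x k).tgt = (x (k + 1)).src}

/-- The shift map `(S x)_k = x_{k+1}`. -/
def shift (A : SqMat (MonoidAlgebra ℕ G)) (x : EdgeShift A) : EdgeShift A :=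
  ⟨fun k => x.1 (k + 1), fun k => x.2 (k + 1)⟩

/-- The skewing function of `A`: the label of the edge `x_0`. -/
def skew (A : SqMat (MonoidAlgebra ℕ G)) (x : EdgeShift A) : G := (x.1 0).label

/-- The periodic data `P_A` of the `G`-extension defined by `A`. -/
def P (A : SqMat (MonoidAlgebra ℕ G)) : PowerSeries (ConjClasses G →₀ ℤ) :=
  periodicData (shift A) (skew A)

/-- The collection `𝔐(A)` of the `G`-primitive matrices `B` over `ℤ₊G` such that the augmentations
of `A` and `B` are SSE over `ℤ₊`, and `A` and `B` have the same periodic data. -/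
def 𝔐 (A : SqMat (MonoidAlgebra ℕ G)) : Set (SqMat (MonoidAlgebra ℕ G)) :=
  {B | GPrimitive B ∧ SSE (aug A) (aug B) ∧ P B = P A}

end

end GExt

/-!
The idea is to let `A_k` be a matrix over `ℤ₊G` whose underlying graph is a long path of length `k`
between two looped vertices, closed up by edges labelled uniformly by `G`, i.e. by multiples of the
norm element `N = ∑ g`. An element of `ℤG` is determined by its augmentation and its image modulo
`N`, and these two images of `A_k` are arranged to behave very differently.

* Under the augmentation, the weights on the loops and along the path agree, so lengthening the path
  is a state splitting and all the augmented matrices are SSE over `ℤ₊` (`SSE_aug_chainExt`).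
* Modulo `N`, the matrix is upper triangular with diagonal `(1, 0, …, 0, 1)`, whatever `k` is, and
  its only essential off-diagonal data is the total weight `q ^ k (1 - g)` of the path from one looped
  vertex to the other, where `q = 1 + |G|` and `g ≠ 1`. In effect it is the unipotent matrix with
  this off-diagonal entry.

The periodic data of a matrix is the image of the traces of its powers (`P_eq_mk`). Modulo `N` these
traces are all equal to `2`, and their augmentations do not depend on `k`, so the periodic data does
not depend on `k` (`trace_pow_chainExt`).

On the other hand, whether the image of a matrix over `ℤG ⧸ (N, m)` acts as the identity on its
eventual range is an invariant of SE over `ℤG` (`SE.eventuallyId`). For `A_k` this holds exactly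
when `q ^ k (1 - g)` lies in the ideal `(N, m)` (`eventuallyId_chainExt_iff`); it holds for
`m = q ^ k` and forces `m ∣ 2 q ^ k`. As `q ≥ 3`, this separates the SE classes of all the `A_k`.
-/

namespace GExt

open scoped Matrix

/-! ### The chain matrices -/

section ChainMatrix

variable {S : Type*} [Semiring S]

/-- The adjacency matrix of a graph with vertices `0, …, k + 1`: a loop `x` at `0`, edges of weight
`z` along the path `0 → 1 → ⋯ → k`, an edge `y` from `k` to `k + 1`, a loop `x` at `k + 1`, and an
edge `f` from `k + 1` back to each vertex `0, …, k`. -/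
def chain (k : ℕ) (x z y f : S) : Matrix (Fin (k + 2)) (Fin (k + 2)) S :=
  Matrix.of fun i j =>
    if i.val = k + 1 then (if j.val = k + 1 then x else f)
    else if j.val = i.val + 1 then (if i.val = k then y else z)
    else if i.val = 0 ∧ j.val = 0 then x else 0

theorem chain_apply (k : ℕ) (x z y f : S) (i j : Fin (k + 2)) :
    chain k x z y f i j =
      if i.val = k + 1 then (if j.val = k + 1 then x else f)
      else if j.val = i.val + 1 then (if i.val = k then y else z)
      else if i.val = 0 ∧ j.val = 0 then x else 0 := rfl

theorem chain_map {T : Type*} [Semiring T] (φ : S →+* T) (k : ℕ) (x z y f : S) :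
    (chain k x z y f).map φ = chain k (φ x) (φ z) (φ y) (φ f) := by
  ext i j
  simp only [Matrix.map_apply, chain_apply, apply_ite φ, map_zero]

/-- The division matrix of the state splitting of vertex `0` of `chain k` into the vertices `0` and
`1` of `chain (k + 1)`. Truncated subtraction sends both `0` and `1` to `0`, as it should. -/
def splitLeft (S : Type*) [Semiring S] (k : ℕ) : Matrix (Fin (k + 2)) (Fin (k + 3)) S :=
  Matrix.of fun i j => if i.val = j.val - 1 then 1 else 0

/-- The edge matrix of the splitting of vertex `0` of `chain k`: the edges starting at `0` are
distributed between the new vertices `0` (the loop) and `1` (the edge leaving vertex `0`). -/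
def splitRight (k : ℕ) (w y f : S) : Matrix (Fin (k + 3)) (Fin (k + 2)) S :=
  Matrix.of fun j i =>
    if j.val = k + 2 then (if i.val = k + 1 then w else f)
    else if i.val = j.val then (if j.val = k + 1 then y else w) else 0

theorem splitLeft_mul_splitRight (k : ℕ) (w y f : S) :
    splitLeft S k * splitRight k w y f = chain k w w y f := by
  ext i i'
  have hi := i.isLt
  have hi' := i'.isLt
  rw [Matrix.mul_apply, Fin.sum_univ_succ, Finset.sum_eq_single i]
  · have h0 : splitLeft S k i 0 = if i.val = 0 then 1 else 0 := rfl
    have h1 : splitLeft S k i i.succ = 1 := if_pos rfl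
    rw [h0, h1, one_mul, ite_mul, one_mul, zero_mul]
    simp only [splitRight, Matrix.of_apply, chain_apply, Fin.val_succ, Fin.val_zero]
    grind
  · intro j _ hj
    have hj' : i.val ≠ j.val := fun h => hj (Fin.ext h.symm)
    simp [splitLeft, hj']
  · simp

theorem splitRight_mul_splitLeft (k : ℕ) (w y f : S) :
    splitRight k w y f * splitLeft S k = chain (k + 1) w w y f := by
  ext j i'
  have hi' := i'.isLt
  have hj := j.isLt
  rw [Matrix.mul_apply, Finset.sum_eq_single ⟨i'.val - 1, by omega⟩]
  · simp only [splitLeft, splitRight, Matrix.of_apply, chain_apply, if_true, mul_one]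
    grind
  · intro l _ hl
    have hl' : l.val ≠ i'.val - 1 := fun h => hl (Fin.ext h)
    simp [splitLeft, hl']
  · simp

/-- If the loops and the edges along the path carry the same weight `w`, then the vertices
`0, …, k` come from a single state with a loop `w` and an exit `y`: at vertex `i` with `0 < i` a walk
takes the loop exactly `k - i` more times before it exits, at vertex `0` at least `k` times.
Recording one more step is a state splitting. -/
theorem elemSSE_chain (k : ℕ) (w y f : S) :
    ElemSSE ⟨k + 2, chain k w w y f⟩ ⟨k + 3, chain (k + 1) w w y f⟩ :=
  ⟨splitLeft S k, splitRight k w y f, (splitLeft_mul_splitRight k w y f).symm,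
    (splitRight_mul_splitLeft k w y f).symm⟩

theorem SSE_chain (k : ℕ) (w y f : S) :
    SSE (⟨2, chain 0 w w y f⟩ : SqMat S) ⟨k + 2, chain k w w y f⟩ := by
  induction k with
  | zero => exact Relation.ReflTransGen.refl
  | succ k ih => exact ih.tail (elemSSE_chain k w y f)

theorem chain_mulVec_first (k : ℕ) (z y : S) (s : S) :
    chain k 1 z y 0 *ᵥ Pi.single 0 s = Pi.single 0 s := by
  funext i
  have hi := i.isLt
  rw [Matrix.mulVec_single]
  simp only [Pi.smul_apply, Matrix.col_apply, chain_apply, Pi.single_apply, Fin.ext_iff,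
    Fin.val_zero, MulOpposite.smul_eq_mul_unop, MulOpposite.unop_op]
  split_ifs <;> simp_all

theorem chain_mulVec_succ (k : ℕ) (z y : S) (s : S) (j : ℕ) (hj : j < k) :
    chain k 1 z y 0 *ᵥ Pi.single ⟨j + 1, by omega⟩ s = Pi.single ⟨j, by omega⟩ (z * s) := by
  funext i
  have hi := i.isLt
  rw [Matrix.mulVec_single]
  simp only [Pi.smul_apply, Matrix.col_apply, chain_apply, Pi.single_apply, Fin.ext_iff,
    MulOpposite.smul_eq_mul_unop, MulOpposite.unop_op]
  split_ifs <;> simp_all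

theorem chain_mulVec_last (k : ℕ) (z y : S) (s : S) :
    chain k 1 z y 0 *ᵥ Pi.single (Fin.last (k + 1)) s =
      Pi.single ⟨k, by omega⟩ (y * s) + Pi.single (Fin.last (k + 1)) s := by
  funext i
  have hi := i.isLt
  rw [Matrix.mulVec_single]
  simp only [Pi.smul_apply, Matrix.col_apply, chain_apply, Pi.single_apply, Fin.ext_iff,
    MulOpposite.smul_eq_mul_unop, MulOpposite.unop_op, Pi.add_apply, Fin.val_last]
  split_ifs <;> simp_all

theorem chain_pow_mulVec_first (k : ℕ) (z y : S) (s : S) (l : ℕ) :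
    chain k 1 z y 0 ^ l *ᵥ Pi.single 0 s = Pi.single 0 s := by
  induction l with
  | zero => rw [pow_zero, Matrix.one_mulVec]
  | succ l ih => rw [pow_succ, ← Matrix.mulVec_mulVec, chain_mulVec_first, ih]

theorem chain_pow_mulVec (k : ℕ) (z y : S) (j l : ℕ) (hj : j ≤ k) (hl : j ≤ l) (s : S) :
    chain k 1 z y 0 ^ l *ᵥ Pi.single ⟨j, by omega⟩ s = Pi.single 0 (z ^ j * s) := by
  induction j generalizing l s with
  | zero => simpa using chain_pow_mulVec_first k z y s l
  | succ j ih =>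
    obtain ⟨l, rfl⟩ : ∃ l', l = l' + 1 := ⟨l - 1, by omega⟩
    rw [pow_succ, ← Matrix.mulVec_mulVec, chain_mulVec_succ k z y s j (by omega),
      ih l (by omega) (by omega), pow_succ, mul_assoc]

end ChainMatrix

section ChainRing

variable {S : Type*} [Ring S]

/-- With `x = 1` and `f = 0` the only obstruction to `chain k` being the identity on its eventual
range is the total weight `z ^ k * y` of the path from vertex `0` to vertex `k + 1`. -/
theorem exists_sub_one_mul_pow_chain_eq_zero_iff (k : ℕ) (z y : S) :
    (∃ l : ℕ, (chain k 1 z y 0 - 1) * chain k 1 z y 0 ^ l = 0) ↔ z ^ k * y = 0 := by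
  set C := chain k 1 z y 0 with hC
  -- For `l ≥ k` the matrix `(C - 1) C ^ l` has at most one nonzero entry: `z ^ k * y`, in the first
  -- row of the last column.
  have last : ∀ l s, k ≤ l → ((C - 1) * C ^ l) *ᵥ Pi.single (Fin.last (k + 1)) s =
      Pi.single 0 (z ^ k * (y * s)) := by
    intro l s hl
    have hcomm : (C - 1) * C ^ l = C ^ l * (C - 1) :=
      ((Commute.refl C).sub_left (Commute.one_left C)).pow_right l
    rw [hcomm, ← Matrix.mulVec_mulVec, Matrix.sub_mulVec, Matrix.one_mulVec, hC,
      chain_mulVec_last, add_sub_cancel_right, chain_pow_mulVec k z y k l le_rfl hl]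
  constructor
  · rintro ⟨l, hl⟩
    have h := last (l + k) 1 (by omega)
    rw [pow_add, ← mul_assoc, hl, zero_mul, Matrix.zero_mulVec, mul_one] at h
    simpa using (congrFun h 0).symm
  · intro h
    refine ⟨k, Matrix.ext_of_mulVec_single fun j => ?_⟩
    rw [Matrix.zero_mulVec]
    have hj := j.isLt
    by_cases hjk : j.val = k + 1
    · obtain rfl : j = Fin.last (k + 1) := Fin.ext hjk
      rw [last k 1 le_rfl, mul_one, h, Pi.single_zero]
    · have := chain_pow_mulVec k z y j.val k (by omega) (by omega) 1
      rw [← Matrix.mulVec_mulVec, hC, this, Matrix.sub_mulVec, Matrix.one_mulVec,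
        chain_mulVec_first, sub_self]

end ChainRing

section Triangular

variable {S : Type*} [Semiring S] {n : ℕ}

theorem pow_diag_of_blockTriangular {C : Matrix (Fin n) (Fin n) S} (hC : C.BlockTriangular id)
    (l : ℕ) (i : Fin n) : (C ^ l) i i = C i i ^ l := by
  induction l with
  | zero => simp
  | succ l ih =>
    rw [pow_succ, Matrix.mul_apply, Finset.sum_eq_single i, ih, pow_succ]
    · intro j _ hj
      rcases lt_or_gt_of_ne hj with h | h
      · rw [hC.pow l h, zero_mul]
      · rw [hC h, mul_zero]
    · simp

theorem trace_chain_pow (k : ℕ) (z y : S) (l : ℕ) (hl : l ≠ 0) :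
    (chain k 1 z y 0 ^ l).trace = 2 := by
  have hC : (chain k 1 z y (0 : S)).BlockTriangular id := by
    intro i j hij
    have hi := i.isLt
    have hij' : j.val < i.val := hij
    rw [chain_apply]
    split_ifs <;> first | omega | rfl
  rw [Matrix.trace, Fin.sum_univ_succ, Fin.sum_univ_castSucc]
  simp only [Matrix.diag_apply, pow_diag_of_blockTriangular hC]
  have h0 : chain k 1 z y (0 : S) 0 0 = 1 := by simp [chain_apply]
  have h1 : chain k 1 z y (0 : S) (Fin.last k).succ (Fin.last k).succ = 1 := by simp [chain_apply]
  have h2 : ∀ i : Fin k, chain k 1 z y (0 : S) i.castSucc.succ i.castSucc.succ = 0 := by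
    intro i
    have hi := i.isLt
    simp [chain_apply, hi.ne]
  rw [h0, h1, one_pow, Finset.sum_eq_zero fun i _ => by rw [h2, zero_pow hl], zero_add,
    one_add_one_eq_two]

end Triangular

/-! ### Periodic data as traces -/

section TraceFormula

variable {G : Type*}

/-- The edges of the labelled graph of `A`, as a sigma type. -/
def edgeEquiv (A : SqMat (MonoidAlgebra ℕ G)) :
    Edge A ≃ Σ (i : Fin A.1) (j : Fin A.1) (g : G), Fin ((A.2 i j).coeff g) where
  toFun e := ⟨e.src, e.tgt, e.label, e.index⟩
  invFun s := ⟨s.1, s.2.1, s.2.2.1, s.2.2.2⟩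
  left_inv _ := rfl
  right_inv _ := rfl

instance [Finite G] (A : SqMat (MonoidAlgebra ℕ G)) : Finite (Edge A) :=
  Finite.of_equiv _ (edgeEquiv A).symm

open Classical in
theorem apply_eq_sum_edges [Finite G] (A : SqMat (MonoidAlgebra ℕ G)) [Fintype (Edge A)]
    (i j : Fin A.1) :
    A.2 i j = ∑ e : Edge A,
      if e.src = i ∧ e.tgt = j then MonoidAlgebra.single e.label 1 else 0 := by
  have := Fintype.ofFinite G
  rw [← (edgeEquiv A).symm.sum_comp, Fintype.sum_sigma, Finset.sum_eq_single i,
    Fintype.sum_sigma, Finset.sum_eq_single j, Fintype.sum_sigma]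
  · ext h
    simp [edgeEquiv]
  · intro b _ hb
    exact Finset.sum_eq_zero fun s _ => if_neg fun h => hb h.2
  · simp
  · intro b _ hb
    exact Finset.sum_eq_zero fun s _ => if_neg fun h => hb h.1
  · simp

/-- The sequence of edges `p` is a path from `i` to `j`. -/
def IsPath {A : SqMat (MonoidAlgebra ℕ G)} :
    ∀ {n : ℕ}, (Fin n → Edge A) → Fin A.1 → Fin A.1 → Prop
  | 0, _, i, j => i = j
  | _ + 1, p, i, j => (p 0).src = i ∧ IsPath (Fin.tail p) (p 0).tgt j

open Classical in
theorem pow_apply_eq_sum_paths [Group G] [Finite G] (A : SqMat (MonoidAlgebra ℕ G))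
    [Fintype (Edge A)] (n : ℕ) (i j : Fin A.1) :
    (A.2 ^ n) i j = ∑ p : Fin n → Edge A,
      if IsPath p i j then
        MonoidAlgebra.single (List.ofFn fun l => (p l).label).prod 1 else 0 := by
  induction n generalizing i with
  | zero => simp [IsPath, Matrix.one_apply, MonoidAlgebra.one_def]
  | succ n ih =>
    rw [pow_succ', Matrix.mul_apply, ← (Fin.consEquiv fun _ => Edge A).sum_comp,
      Fintype.sum_prod_type]
    simp_rw [apply_eq_sum_edges A i, Finset.sum_mul]
    rw [Finset.sum_comm]
    refine Finset.sum_congr rfl fun e _ => ?_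
    rw [Finset.sum_eq_single e.tgt]
    · rw [ih, Finset.mul_sum]
      refine Finset.sum_congr rfl fun p _ => ?_
      by_cases h1 : e.src = i <;> by_cases h2 : IsPath p e.tgt j <;>
        simp [IsPath, h1, h2, Fin.consEquiv, List.ofFn_succ, MonoidAlgebra.single_mul_single]
    · intro b _ hb
      rw [if_neg fun h => hb h.2.symm, zero_mul]
    · simp

theorem isPath_succ_iff {A : SqMat (MonoidAlgebra ℕ G)} {n : ℕ} (p : Fin (n + 1) → Edge A)
    (i j : Fin A.1) :
    IsPath p i j ↔ (p 0).src = i ∧ (∀ l : Fin n, (p l.castSucc).tgt = (p l.succ).src) ∧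
      (p (Fin.last n)).tgt = j := by
  induction n generalizing i with
  | zero => simp [IsPath]
  | succ n ih =>
    rw [IsPath, ih, Fin.forall_fin_succ (n := n)]
    simp only [Fin.tail, Fin.castSucc_zero, Fin.succ_last, Fin.succ_castSucc]
    rw [and_assoc, eq_comm (a := (p 0).tgt)]

/-- The sequence of `n + 1` edges `p` is a closed path. -/
def IsCycle {A : SqMat (MonoidAlgebra ℕ G)} {n : ℕ} (p : Fin (n + 1) → Edge A) : Prop :=
  (∀ l : Fin n, (p l.castSucc).tgt = (p l.succ).src) ∧ (p (Fin.last n)).tgt = (p 0).src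

open Classical in
theorem trace_pow_eq_sum_cycles [Group G] [Finite G] (A : SqMat (MonoidAlgebra ℕ G))
    [Fintype (Edge A)] (n : ℕ) :
    (A.2 ^ (n + 1)).trace = ∑ p : Fin (n + 1) → Edge A,
      if IsCycle p then
        MonoidAlgebra.single (List.ofFn fun l => (p l).label).prod 1 else 0 := by
  simp only [Matrix.trace, Matrix.diag_apply, pow_apply_eq_sum_paths]
  rw [Finset.sum_comm]
  refine Finset.sum_congr rfl fun p _ => ?_
  rw [Finset.sum_eq_single (p 0).src]
  · simp [isPath_succ_iff, IsCycle]
  · intro b _ hb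
    rw [if_neg]
    exact fun h => hb ((isPath_succ_iff p b b).1 h).1.symm
  · simp

theorem iterate_shift_apply (A : SqMat (MonoidAlgebra ℕ G)) (n : ℕ) (x : EdgeShift A) (k : ℤ) :
    ((shift A)^[n] x).1 k = x.1 (k + n) := by
  induction n generalizing x with
  | zero => simp
  | succ n ih =>
    rw [Function.iterate_succ_apply, ih]
    change x.1 (k + n + 1) = _
    push_cast
    rw [add_assoc]

/-- Reading off the edges at positions `0, …, n` identifies the points of period `n + 1` with the
closed paths of length `n + 1`. -/
theorem bijOn_fixed_cycles (A : SqMat (MonoidAlgebra ℕ G)) (n : ℕ) :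
    Set.BijOn (fun (x : EdgeShift A) (l : Fin (n + 1)) => x.1 (l.val : ℤ))
      {x | (shift A)^[n + 1] x = x} {p | IsCycle p} := by
  have per : ∀ x : EdgeShift A, (shift A)^[n + 1] x = x →
      Function.Periodic x.1 ((n + 1 : ℕ) : ℤ) := by
    intro x hx k
    rw [← iterate_shift_apply, hx]
  have perMod : ∀ x : EdgeShift A, (shift A)^[n + 1] x = x →
      ∀ k, x.1 k = x.1 (k % (n + 1 : ℕ)) := by
    intro x hx k
    rw [Int.emod_def, mul_comm, ← smul_eq_mul, (per x hx).sub_zsmul_eq]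
  refine ⟨?_, ?_, ?_⟩
  · intro x hx
    refine ⟨fun l => ?_, ?_⟩
    · simpa using x.2 l.val
    · have h := x.2 n
      have h' := per x hx 0
      simp only [zero_add, Nat.cast_add, Nat.cast_one] at h'
      simpa [h'] using h
  · intro x hx y hy hxy
    refine Subtype.ext (funext fun k => ?_)
    have hpos : ((n + 1 : ℕ) : ℤ) ≠ 0 := by omega
    have h0 := Int.emod_nonneg k hpos
    have h1 := Int.emod_lt_of_pos k (show (0 : ℤ) < (n + 1 : ℕ) by omega)
    have key := congrFun hxy ⟨(k % (n + 1 : ℕ)).toNat, by omega⟩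
    simp only [Int.toNat_of_nonneg h0] at key
    rw [perMod x hx, perMod y hy]
    exact key
  · intro p hp
    have hlt : ∀ k : ℤ, (k % ((n + 1 : ℕ) : ℤ)).toNat < n + 1 := by
      intro k
      have := Int.emod_lt_of_pos k (show (0 : ℤ) < (n + 1 : ℕ) by omega)
      omega
    have ex : ∃ x : EdgeShift A, ∀ k, x.1 k = p ⟨(k % (n + 1 : ℕ)).toNat, hlt k⟩ := by
      refine ⟨⟨fun k => p ⟨(k % (n + 1 : ℕ)).toNat, hlt k⟩, fun k => ?_⟩, fun _ => rfl⟩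
      have h0 := Int.emod_nonneg k (show ((n + 1 : ℕ) : ℤ) ≠ 0 by omega)
      have h1 := Int.emod_lt_of_pos k (show (0 : ℤ) < (n + 1 : ℕ) by omega)
      by_cases hk : k % (n + 1 : ℕ) = n
      · have e1 : (⟨(k % (n + 1 : ℕ)).toNat, hlt k⟩ : Fin (n + 1)) = Fin.last n :=
          Fin.ext (by change (k % (n + 1 : ℕ)).toNat = n; omega)
        have e2 : (⟨((k + 1) % (n + 1 : ℕ)).toNat, hlt (k + 1)⟩ : Fin (n + 1)) = 0 :=
          Fin.ext (by
            change ((k + 1) % (n + 1 : ℕ)).toNat = 0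
            have hs : (k + 1) % (n + 1 : ℕ) = 0 := by
              rw [← Int.emod_add_emod, hk]
              simp
            omega)
        simp only [e1, e2]
        exact hp.2
      · have hs : (k + 1) % (n + 1 : ℕ) = k % (n + 1 : ℕ) + 1 := by
          rw [← Int.emod_add_emod]
          exact Int.emod_eq_of_lt (by omega) (by omega)
        have e := hp.1 ⟨(k % (n + 1 : ℕ)).toNat, by omega⟩
        have e2 : (⟨((k + 1) % (n + 1 : ℕ)).toNat, hlt (k + 1)⟩ : Fin (n + 1)) =
            Fin.succ ⟨(k % (n + 1 : ℕ)).toNat, by omega⟩ :=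
          Fin.ext (by simp only [Fin.val_succ]; omega)
        simp only [e2]
        exact e
    obtain ⟨x, hx⟩ := ex
    refine ⟨x, ?_, ?_⟩
    · refine Subtype.ext (funext fun k => ?_)
      rw [iterate_shift_apply, hx, hx]
      simp
    · funext l
      have hl := l.isLt
      refine (hx _).trans (congrArg p (Fin.ext ?_))
      change ((l.val : ℤ) % (n + 1 : ℕ)).toNat = l.val
      rw [Int.emod_eq_of_lt (by omega) (by omega)]
      simp

/-- The additive map from `ℤ₊G` sending a group element to its conjugacy class. -/
noncomputable def classHom (G : Type*) [Group G] : MonoidAlgebra ℕ G →+ (ConjClasses G →₀ ℤ) :=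
  (Finsupp.mapDomain.addMonoidHom ConjClasses.mk).comp
    ((Finsupp.mapRange.addMonoidHom (Nat.castAddMonoidHom ℤ)).comp
      MonoidAlgebra.coeffAddEquiv.toAddMonoidHom)

theorem classHom_single [Group G] (g : G) :
    classHom G (MonoidAlgebra.single g 1) = Finsupp.single (ConjClasses.mk g) 1 := by
  simp [classHom]

/-- The coefficient of `t ^ n` in the periodic data of `A` is the image of `tr (A ^ n)`. -/
theorem P_eq_mk [Group G] [Finite G] (A : SqMat (MonoidAlgebra ℕ G)) :
    P A = PowerSeries.mk fun n => if n = 0 then 0 else classHom G (A.2 ^ n).trace := by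
  classical
  have := Fintype.ofFinite (Edge A)
  rw [P, periodicData]
  congr 1
  funext n
  obtain _ | n := n
  · simp
  rw [if_neg n.succ_ne_zero, if_neg n.succ_ne_zero,
    finsum_mem_eq_of_bijOn _ (bijOn_fixed_cycles A n) (g := fun p =>
      Finsupp.single (ConjClasses.mk (List.ofFn fun l => (p l).label).prod) 1),
    trace_pow_eq_sum_cycles, map_sum, finsum_mem_def, finsum_eq_sum_of_fintype]
  · refine Finset.sum_congr rfl fun p _ => ?_
    by_cases hp : IsCycle p <;> simp [hp, classHom_single, Set.indicator]
  · intro x _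
    simp [skew, iterate_shift_apply]

theorem P_eq_of_trace_eq [Group G] [Finite G] {A B : SqMat (MonoidAlgebra ℕ G)}
    (h : ∀ n, n ≠ 0 → (A.2 ^ n).trace = (B.2 ^ n).trace) : P A = P B := by
  rw [P_eq_mk, P_eq_mk]
  congr 1
  funext n
  split_ifs with hn
  · rfl
  · rw [h n hn]

end TraceFormula

/-! ### Primitivity -/

section FullSupport

variable {G : Type*}

/-- All coefficients of `u` are positive: `u ≫ 0`. -/
def Full (u : MonoidAlgebra ℕ G) : Prop := ∀ g, 0 < u.coeff g

theorem Full.add_left {u v : MonoidAlgebra ℕ G} (hv : Full v) : Full (u + v) := fun g => by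
  simpa using Nat.add_pos_right _ (hv g)

variable [Group G]

theorem Full.mul {u v : MonoidAlgebra ℕ G} (hu : Full u) (hv : Full v) : Full (u * v) := by
  intro g
  rw [MonoidAlgebra.coeff_mul_apply_left]
  refine Finset.sum_pos (fun h _ => Nat.mul_pos (hu h) (hv _)) ⟨1, ?_⟩
  exact Finsupp.mem_support_iff.2 (hu 1).ne'

theorem Full.matrix_mul {l m n : ℕ} {A : Matrix (Fin l) (Fin m) (MonoidAlgebra ℕ G)}
    {B : Matrix (Fin m) (Fin n) (MonoidAlgebra ℕ G)} {i : Fin l} {j : Fin m} {k : Fin n}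
    (hA : Full (A i j)) (hB : Full (B j k)) : Full ((A * B) i k) := by
  intro g
  rw [Matrix.mul_apply, MonoidAlgebra.coeff_sum, Finsupp.finsetSum_apply]
  exact (hA.mul hB g).trans_le
    (Finset.single_le_sum (f := fun j => (A i j * B j k).coeff g) (fun _ _ => Nat.zero_le _)
      (Finset.mem_univ j))

theorem gPrimitive_chain (k : ℕ) {x z y f : MonoidAlgebra ℕ G} (hx : Full x) (hz : Full z)
    (hy : Full y) (hf : Full f) : GPrimitive ⟨k + 2, chain k x z y f⟩ := by
  -- Vertex `i` reaches the last one along the path, and any steps left over are spent on its loop.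
  have reach : ∀ (s : ℕ) (i : Fin (k + 2)), k + 1 ≤ i.val + s →
      Full ((chain k x z y f ^ (s + 1)) i (Fin.last (k + 1))) := by
    intro s
    induction s with
    | zero =>
      intro i hi
      obtain rfl : i = Fin.last (k + 1) :=
        Fin.ext (by have := i.isLt; simp only [Fin.val_last]; omega)
      simpa [chain_apply] using hx
    | succ s ih =>
      intro i hi
      rw [pow_succ']
      by_cases h : i.val = k + 1
      · refine Full.matrix_mul (j := Fin.last (k + 1)) ?_
          (ih _ (by simp only [Fin.val_last]; omega))
        simpa [chain_apply, h] using hx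
      · have hi' := i.isLt
        refine Full.matrix_mul (j := ⟨i.val + 1, by omega⟩) ?_ (ih _ (by simp only; omega))
        rw [chain_apply, if_neg h, if_pos rfl]
        split_ifs <;> assumption
  refine ⟨Nat.succ_pos _, k + 3, Nat.succ_pos _, fun (i : Fin (k + 2)) (j : Fin (k + 2)) => ?_⟩
  change Full ((chain k x z y f ^ (k + 2 + 1)) i j)
  rw [pow_succ]
  refine Full.matrix_mul (reach (k + 1) i (by omega)) ?_
  rw [chain_apply, if_pos (by simp)]
  split_ifs <;> assumption

end FullSupport

/-! ### The norm element and its ideals -/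

section Norm

/-- The norm element `N = ∑ g`. It satisfies `u N = N u = ε(u) N`, where `ε` is the augmentation. -/
noncomputable def normElt (R : Type*) [Semiring R] (G : Type*) [Fintype G] : MonoidAlgebra R G :=
  ∑ g : G, MonoidAlgebra.single g 1

@[simp]
theorem coeff_normElt (R : Type*) [Semiring R] {G : Type*} [Fintype G] (g : G) :
    (normElt R G).coeff g = 1 := by
  classical
  simp [normElt, Finsupp.finsetSum_apply, Finsupp.single_apply]

theorem full_normElt {G : Type*} [Fintype G] : Full (normElt ℕ G) := fun g => by simp

variable {G : Type*} [Group G] [Fintype G]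

theorem exists_mul_normElt (u : MonoidAlgebra ℤ G) :
    ∃ a : ℤ, u * normElt ℤ G = a • normElt ℤ G := by
  induction u using MonoidAlgebra.induction_linear with
  | zero => exact ⟨0, by simp⟩
  | add u v hu hv =>
    obtain ⟨a, ha⟩ := hu
    obtain ⟨b, hb⟩ := hv
    exact ⟨a + b, by rw [add_mul, ha, hb, add_smul]⟩
  | single g r =>
    refine ⟨r, ?_⟩
    ext h
    simp [MonoidAlgebra.coeff_single_mul_apply, -zsmul_eq_mul]

theorem exists_normElt_mul (u : MonoidAlgebra ℤ G) :
    ∃ a : ℤ, normElt ℤ G * u = a • normElt ℤ G := by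
  induction u using MonoidAlgebra.induction_linear with
  | zero => exact ⟨0, by simp⟩
  | add u v hu hv =>
    obtain ⟨a, ha⟩ := hu
    obtain ⟨b, hb⟩ := hv
    exact ⟨a + b, by rw [mul_add, ha, hb, add_smul]⟩
  | single g r =>
    refine ⟨r, ?_⟩
    ext h
    simp [MonoidAlgebra.coeff_mul_single_apply, -zsmul_eq_mul]

variable (G)

/-- The ideal of `ℤG` generated by `m` and by the norm element. -/
noncomputable def normIdeal (m : ℤ) : Ideal (MonoidAlgebra ℤ G) where
  carrier := {u | ∃ (a : ℤ) (v : MonoidAlgebra ℤ G), u = a • normElt ℤ G + m • v}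
  zero_mem' := ⟨0, 0, by simp⟩
  add_mem' := by
    rintro _ _ ⟨a, v, rfl⟩ ⟨b, w, rfl⟩
    exact ⟨a + b, v + w, by rw [add_smul, smul_add]; abel⟩
  smul_mem' := by
    rintro u _ ⟨a, v, rfl⟩
    obtain ⟨b, hb⟩ := exists_mul_normElt u
    exact ⟨a * b, u * v, by
      rw [smul_eq_mul, mul_add, mul_smul_comm, mul_smul_comm, hb, mul_smul]⟩

instance (m : ℤ) : (normIdeal G m).IsTwoSided where
  mul_mem_of_left := by
    rintro _ u ⟨a, v, rfl⟩
    obtain ⟨b, hb⟩ := exists_normElt_mul u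
    exact ⟨a * b, v * u, by
      rw [add_mul, smul_mul_assoc, smul_mul_assoc, hb, mul_smul]⟩

end Norm

/-! ### An invariant of shift equivalence -/

section Invariant

variable {R T : Type*} [Ring R] [Ring T]

/-- The image of the square matrix `D` over `T` satisfies `(D - 1) D ^ l = 0` for some `l`: it acts
as the identity on its eventual range. -/
def EventuallyId (φ : R →+* T) (D : SqMat R) : Prop :=
  ∃ l : ℕ, (D.2.map φ - 1) * D.2.map φ ^ l = 0

theorem SE.eventuallyId {φ : R →+* T} {C D : SqMat R} (h : SE C D) (hC : EventuallyId φ C) :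
    EventuallyId φ D := by
  obtain ⟨l, U, V, -, -, h2, -, h4⟩ := h
  obtain ⟨k, hk⟩ := hC
  have e2 : D.2.map φ ^ l = V.map φ * U.map φ := by
    rw [← Matrix.map_mul, ← h2, Matrix.map_pow]
  have e4 : D.2.map φ * V.map φ = V.map φ * C.2.map φ := by
    rw [← Matrix.map_mul, h4, Matrix.map_mul]
  refine ⟨k + l, ?_⟩
  have e5 : (D.2.map φ - 1) * V.map φ = V.map φ * (C.2.map φ - 1) := by
    rw [Matrix.sub_mul, Matrix.mul_sub, e4, Matrix.one_mul, Matrix.mul_one]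
  rw [pow_add, e2, ← Matrix.mul_assoc, ← Matrix.mul_assoc, Matrix.mul_assoc _ (_ ^ k),
    pow_intertwine e4, ← Matrix.mul_assoc, e5, Matrix.mul_assoc (V.map φ), hk, Matrix.mul_zero,
    Matrix.zero_mul]

theorem eventuallyId_congr (φ : R →+* T) {C D : SqMat R} (h : seClass C = seClass D) :
    EventuallyId φ C ↔ EventuallyId φ D := by
  have h' : SE C D := Quotient.exact h
  exact ⟨h'.eventuallyId, h'.symm.eventuallyId⟩

end Invariant

/-! ### Traces and augmentation -/

section Trace

theorem trace_map {R T : Type*} [Semiring R] [Semiring T] (φ : R →+* T) {n : ℕ}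
    (A : Matrix (Fin n) (Fin n) R) (l : ℕ) : ((A.map φ) ^ l).trace = φ ((A ^ l).trace) := by
  rw [← Matrix.map_pow, Matrix.trace, Matrix.trace, map_sum]
  rfl

theorem SSE.trace_pow_eq {R : Type*} [CommSemiring R] {A B : SqMat R} (h : SSE A B) {n : ℕ}
    (hn : n ≠ 0) : (A.2 ^ n).trace = (B.2 ^ n).trace := by
  obtain ⟨n, rfl⟩ := Nat.exists_eq_succ_of_ne_zero hn
  induction h with
  | refl => rfl
  | tail _ h ih =>
    obtain ⟨U, V, h1, h2⟩ := h
    have e : U * (V * U) = (U * V) * U := (Matrix.mul_assoc _ _ _).symm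
    rw [ih, h1, h2, pow_succ, ← Matrix.mul_assoc, pow_intertwine e.symm, Matrix.mul_assoc,
      Matrix.trace_mul_comm, Matrix.mul_assoc, ← pow_succ]

/-- The inclusion of `ℤ₊G` into `ℤG`. -/
noncomputable abbrev incl (G : Type*) [Group G] : MonoidAlgebra ℕ G →+* MonoidAlgebra ℤ G :=
  MonoidAlgebra.mapRingHom G (Nat.castRingHom ℤ)

/-- The augmentation `∑ n_g g ↦ ∑ n_g` of `ℤG`. -/
noncomputable def augZ (G : Type*) [Group G] : MonoidAlgebra ℤ G →+* ℤ :=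
  (MonoidAlgebra.lift ℤ ℤ G 1).toRingHom

theorem augZ_incl {G : Type*} [Group G] (u : MonoidAlgebra ℕ G) :
    augZ G (incl G u) = (MonoidAlgebra.lift ℕ ℕ G 1 u : ℕ) := by
  induction u using MonoidAlgebra.induction_linear with
  | zero => simp
  | add u v hu hv => simp only [map_add, hu, hv, Nat.cast_add]
  | single g r => simp [augZ]

end Trace

/-! ### The family of extensions -/

section Family

variable {G : Type*} [Group G] [Fintype G]

/-- The element `1 - g + 2 N` of `ℤ₊G`, with `N` the norm element; here `(N.erase g) = N - g`. -/
noncomputable def link (g : G) : MonoidAlgebra ℕ G :=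
  1 + normElt ℕ G + (normElt ℕ G).erase g

/-- The `k`-th extension: the chain matrix with loops `1 + 2 N`, weights `1 + |G| + N` along the
path, `1 - g + 2 N` on the edge that ends it, and `N` on the edges going back. The loops and the path
have the same augmentation `1 + 2 |G|`, and modulo `N` the weights become `1`, `1 + |G|`, `1 - g`
and `0`. -/
noncomputable def chainExt (g : G) (k : ℕ) : SqMat (MonoidAlgebra ℕ G) :=
  ⟨k + 2, chain k (1 + 2 * normElt ℕ G)
    (((1 + Fintype.card G : ℕ) : MonoidAlgebra ℕ G) + normElt ℕ G)
    (link g) (normElt ℕ G)⟩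

theorem gPrimitive_chainExt (g : G) (k : ℕ) : GPrimitive (chainExt g k) := by
  refine gPrimitive_chain k ?_ full_normElt.add_left ?_ full_normElt
  · rw [two_mul]
    exact full_normElt.add_left.add_left
  · rw [link, add_right_comm]
    exact full_normElt.add_left

theorem SSE_aug_chainExt (g : G) (k : ℕ) : SSE (aug (chainExt g 0)) (aug (chainExt g k)) := by
  have h : MonoidAlgebra.lift ℕ ℕ G 1 (normElt ℕ G) = Fintype.card G := by
    simp [normElt]
  have key : ∀ k, aug (chainExt g k) = ⟨k + 2, chain k (1 + 2 * Fintype.card G)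
      (1 + 2 * Fintype.card G)
      (MonoidAlgebra.lift ℕ ℕ G 1 (link g)) (Fintype.card G)⟩ := by
    intro k
    refine congrArg (Sigma.mk (k + 2)) ?_
    refine (chain_map (MonoidAlgebra.lift ℕ ℕ G 1).toRingHom k _ _ _ _).trans ?_
    have e : (MonoidAlgebra.lift ℕ ℕ G 1)
        (((1 + Fintype.card G : ℕ) : MonoidAlgebra ℕ G) + normElt ℕ G)
        = 1 + 2 * Fintype.card G := by
      rw [map_add, map_natCast, h]; simp; ring
    simp only [AlgHom.toRingHom_eq_coe, RingHom.coe_coe, e, h]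
    rw [map_add, map_mul, h, map_one, map_ofNat]
  rw [key, key]
  exact SSE_chain k _ _ _

theorem incl_normElt : incl G (normElt ℕ G) = normElt ℤ G := by
  ext g; simp

theorem incl_link (g : G) :
    incl G (link g) = 1 - MonoidAlgebra.single g 1 + (2 : ℤ) • normElt ℤ G := by
  classical
  ext h
  by_cases hg : h = g <;>
  simp [link, MonoidAlgebra.one_def, Finsupp.single_apply, hg, eq_comm, -zsmul_eq_mul] <;> ring

theorem mk_normElt (m : ℤ) : Ideal.Quotient.mk (normIdeal G m) (normElt ℤ G) = 0 :=
  Ideal.Quotient.eq_zero_iff_mem.2 ⟨1, 0, by simp⟩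

theorem map_chainExt (g : G) (k : ℕ) (m : ℤ) :
    (toZG (chainExt g k)).2.map (Ideal.Quotient.mk (normIdeal G m)) =
      chain k 1 ((1 + Fintype.card G : ℕ) : MonoidAlgebra ℤ G ⧸ normIdeal G m)
        (Ideal.Quotient.mk _ (1 - MonoidAlgebra.single g 1)) 0 := by
  have e : (toZG (chainExt g k)).2 = (chainExt g k).2.map (incl G) := rfl
  rw [e]
  change ((chain k _ _ _ _).map (incl G)).map _ = _
  rw [chain_map, chain_map, incl_link]
  simp only [map_add, map_mul, map_one, map_natCast, incl_normElt, mk_normElt, map_zsmul]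
  simp

theorem eventuallyId_chainExt_iff (g : G) (k : ℕ) (m : ℤ) :
    EventuallyId (Ideal.Quotient.mk (normIdeal G m)) (toZG (chainExt g k)) ↔
      ((1 + Fintype.card G : ℕ) : MonoidAlgebra ℤ G) ^ k * (1 - MonoidAlgebra.single g 1) ∈
        normIdeal G m := by
  rw [EventuallyId, map_chainExt]
  refine (exists_sub_one_mul_pow_chain_eq_zero_iff k _ _).trans ?_
  rw [← Ideal.Quotient.eq_zero_iff_mem, map_mul, map_pow, map_natCast]

theorem eventuallyId_chainExt_self (g : G) (k : ℕ) :
    EventuallyId (Ideal.Quotient.mk (normIdeal G ((1 + Fintype.card G : ℕ) ^ k : ℤ)))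
      (toZG (chainExt g k)) := by
  rw [eventuallyId_chainExt_iff]
  exact ⟨0, 1 - MonoidAlgebra.single g 1, by
    rw [zero_smul, zero_add, ← Int.cast_smul_eq_zsmul (MonoidAlgebra ℤ G)]; simp⟩

/-- An element of the ideal has all its coefficients congruent modulo `m`; compare those of
`(1 + |G|) ^ k (1 - g)` at `1` and at `g`. -/
theorem dvd_of_eventuallyId_chainExt {g : G} (hg : g ≠ 1) {k : ℕ} {m : ℤ}
    (h : EventuallyId (Ideal.Quotient.mk (normIdeal G m)) (toZG (chainExt g k))) :
    m ∣ 2 * ((1 + Fintype.card G : ℕ) : ℤ) ^ k := by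
  rw [eventuallyId_chainExt_iff] at h
  obtain ⟨a, v, hv⟩ := h
  have e : ((1 + Fintype.card G : ℕ) : MonoidAlgebra ℤ G) ^ k =
      MonoidAlgebra.single 1 (((1 + Fintype.card G : ℕ) : ℤ) ^ k) := by
    rw [MonoidAlgebra.natCast_def, MonoidAlgebra.single_pow, one_pow]
  rw [e] at hv
  have h1 := congrArg (fun u => u.coeff 1) hv
  have h2 := congrArg (fun u => u.coeff g) hv
  simp [MonoidAlgebra.coeff_single_mul_apply, MonoidAlgebra.one_def, hg, hg.symm,
    -zsmul_eq_mul] at h1 h2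
  refine ⟨v.coeff 1 - v.coeff g, ?_⟩
  push_cast
  linarith

/-- Modulo `N` the matrix is triangular with diagonal `(1, 0, …, 0, 1)`, so the trace is `2 + a N`
for an integer `a`; and `a` is determined by the augmentation, which strong shift equivalence
preserves. -/
theorem trace_pow_chainExt (g : G) (k : ℕ) {n : ℕ} (hn : n ≠ 0) :
    ((chainExt g k).2 ^ n).trace = ((chainExt g 0).2 ^ n).trace := by
  have form : ∀ k, ∃ a : ℤ, incl G ((chainExt g k).2 ^ n).trace = 2 + a • normElt ℤ G := by
    intro k
    have h : Ideal.Quotient.mk (normIdeal G 0) (incl G ((chainExt g k).2 ^ n).trace) = 2 := by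
      rw [← trace_map, ← trace_map]
      exact (congrArg (fun M => Matrix.trace (M ^ n)) (map_chainExt g k 0)).trans
        (trace_chain_pow k _ _ n hn)
    have h' : Ideal.Quotient.mk (normIdeal G 0) (incl G ((chainExt g k).2 ^ n).trace - 2) = 0 := by
      rw [map_sub, h, map_ofNat, sub_self]
    obtain ⟨a, v, hv⟩ := Ideal.Quotient.eq_zero_iff_mem.1 h'
    exact ⟨a, by rw [← sub_eq_iff_eq_add', hv, zero_smul, add_zero]⟩
  have haug : ∀ k,
      augZ G (incl G ((chainExt g k).2 ^ n).trace) = ((aug (chainExt g k)).2 ^ n).trace := by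
    intro k
    rw [augZ_incl]
    exact congrArg _ (trace_map (MonoidAlgebra.lift ℕ ℕ G 1).toRingHom (chainExt g k).2 n).symm
  have hN : augZ G (normElt ℤ G) ≠ 0 := by
    simp [augZ, normElt]
  obtain ⟨a, ha⟩ := form k
  obtain ⟨b, hb⟩ := form 0
  have hab := (haug k).trans
    ((congrArg Nat.cast ((SSE_aug_chainExt g k).trace_pow_eq hn)).symm.trans (haug 0).symm)
  rw [ha, hb, map_add, map_add, map_zsmul, map_zsmul, add_right_inj, smul_eq_mul, smul_eq_mul,
    mul_left_inj' hN] at hab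
  have hinj : incl G ((chainExt g k).2 ^ n).trace = incl G ((chainExt g 0).2 ^ n).trace := by
    rw [ha, hb, hab]
  ext h
  have := congrArg (fun u => u.coeff h) hinj
  simpa using this

theorem chainExt_mem_𝔐 (g : G) (k : ℕ) : chainExt g k ∈ 𝔐 (chainExt g 0) :=
  ⟨gPrimitive_chainExt g k, SSE_aug_chainExt g k,
    P_eq_of_trace_eq fun _ hn => trace_pow_chainExt g k hn⟩

/-- The matrix with index `k` becomes the identity on its eventual range modulo `N` and
`(1 + |G|) ^ k`, and the one with index `j < k` does not, as `(1 + |G|) ^ k ∤ 2 (1 + |G|) ^ j`. -/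
theorem seClass_chainExt_injective {g : G} (hg : g ≠ 1) :
    Function.Injective fun k => seClass (toZG (chainExt g k)) := by
  intro j k hjk
  wlog hlt : j < k generalizing j k
  · rcases lt_trichotomy j k with h | h | h
    · exact this hjk h
    · exact h
    · exact (this hjk.symm h).symm
  exfalso
  have h := dvd_of_eventuallyId_chainExt hg
    ((eventuallyId_congr _ hjk).2 (eventuallyId_chainExt_self g k))
  have hcard : 1 < Fintype.card G := Fintype.one_lt_card_iff_nontrivial.2 ⟨g, 1, hg⟩
  have h' := Nat.le_of_dvd (by positivity)
    (show (1 + Fintype.card G) ^ k ∣ 2 * (1 + Fintype.card G) ^ j by exact_mod_cast h)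
  have h1 : (1 + Fintype.card G) ^ (j + 1) ≤ (1 + Fintype.card G) ^ k :=
    Nat.pow_le_pow_right (by omega) hlt
  have h2 : 0 < (1 + Fintype.card G) ^ j := by positivity
  rw [pow_succ] at h1
  nlinarith

end Family

end GExt

theorem theorem4p3 (G : Type*) [Group G] [Finite G] [Nontrivial G] :
    ∃ A : GExt.SqMat (MonoidAlgebra ℕ G), GExt.GPrimitive A ∧
      ((fun B => GExt.seClass (GExt.toZG B)) '' GExt.𝔐 A).Infinite := by
  have := Fintype.ofFinite G
  obtain ⟨g, hg⟩ := exists_ne (1 : G)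
  refine ⟨GExt.chainExt g 0, GExt.gPrimitive_chainExt g 0, ?_⟩
  refine Set.Infinite.mono ?_ (Set.infinite_range_of_injective (GExt.seClass_chainExt_injective hg))
  rintro _ ⟨k, rfl⟩
  exact ⟨_, GExt.chainExt_mem_𝔐 g k, rfl⟩
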